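/- Let $d\ge 1$. For each $j=1,\dots,d$ let $p_j,q_j$ be positive, continuously differentiable functions on $(0,1)$ such that $p_j/q_j$ is strictly increasing, and suppose that there are a continuously differentiable function $u_j$ and a continuous function $v_j$ on $(0,1)$ such that $f=p_j$ and $f=q_j$ both satisfy $\frac{d}{dx}\bigl(u_j(x)f'(x)\bigr)+v_j(x)f(x)=0$ for all $x\in(0,1)$. Let $$k(\mathbf x,\mathbf x')=\prod_{j=1}^d p_j(\min(x_j,x_j'))\,q_j(\max(x_j,x_j')),\qquad \mathbf x,\mathbf x'\in(0,1)^d,$$ be the associated tensor Markov kernel, and let $\{Y(\mathbf x):\mathbf x\in(0,1)^d\}$ be a zero mean Gaussian process with covariance function $k$. Suppose that $Y$ is observed without noise at distinct design points $\mathbf x_1,\dots,\mathbf x_n$ that form the full dyadic lattice $\{i\,2^{-\tau}:1\le i\le 2^\tau-1\}^d$ for some integer $\tau\ge1$ (so $n=(2^\tau-1)^d$), and let $$\widehat Y_n(\mathbf x)=\mathbf k(\mathbf x)^{\top}\mathbf K^{-1}\mathbf y,\qquad \mathbf k(\mathbf x)=(k(\mathbf x,\mathbf x_i))_{i\le n},\quad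 \mathbf K=(k(\mathbf x_i,\mathbf x_j))_{i,j\le n},\quad \mathbf y=(Y(\mathbf x_i))_{i\le n},$$ be the kriging predictor. Then there is a constant $c>0$, independent of $n$, such that for all sufficiently large $n$ of this form $$\sup_{\mathbf x\in(0,1)^d}\mathbb E\bigl[(\widehat Y_n(\mathbf x)-Y(\mathbf x))^2\bigr]\ \ge\ c\,n^{-1/d},$$ where the supremum is taken in $[0,\infty]$. -/

import Mathlib

open MeasureTheory ProbabilityTheory Matrix Set Filter
open scoped ENNReal

/-- The open unit cube `(0,1)^d`, the design space. -/
def openCube (d : ℕ) : Set (Fin d → ℝ) := Set.univ.pi fun _ => Set.Ioo (0 : ℝ) 1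

/-- `p` and `q` generate a one-dimensional Gauss-Markov kernel on the set `I`: both are positive
on `I` and `p / q` is strictly increasing on `I`. -/
structure IsMarkovPair (I : Set ℝ) (p q : ℝ → ℝ) : Prop where
  pos_left : ∀ x ∈ I, 0 < p x
  pos_right : ∀ x ∈ I, 0 < q x
  strictMonoOn_div : StrictMonoOn (fun x => p x / q x) I

/-- The tensor Markov kernel `∏ j, p_j (x_j ∧ x'_j) * q_j (x_j ∨ x'_j)` on the open unit cube. -/
def tmKernel {d : ℕ} (p q : Fin d → ℝ → ℝ) (x x' : openCube d) : ℝ :=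
  ∏ j, p j (min (x.1 j) (x'.1 j)) * q j (max (x.1 j) (x'.1 j))

/-- `f` solves the Sturm-Liouville equation `(u f')' + v f = 0` on `(0,1)`; in particular
`u f'` is differentiable there. -/
def SolvesSturmLiouville (u v f : ℝ → ℝ) : Prop :=
  ∀ x ∈ Set.Ioo (0 : ℝ) 1, HasDerivAt (fun t => u t * deriv f t) (-(v x * f x)) x

/-- The regularity condition on one coordinate of the kernel: `p` and `q` are continuously
differentiable on `(0,1)` and both solve one and the same equation `(u f')' + v f = 0`, with `u`
continuously differentiable and `v` continuous. -/
structure SturmLiouvilleRegular (p q : ℝ → ℝ) : Prop where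
  contDiffOn_left : ContDiffOn ℝ 1 p (Set.Ioo 0 1)
  contDiffOn_right : ContDiffOn ℝ 1 q (Set.Ioo 0 1)
  exists_equation : ∃ u v : ℝ → ℝ, ContDiffOn ℝ 1 u (Set.Ioo 0 1) ∧
    ContinuousOn v (Set.Ioo 0 1) ∧ SolvesSturmLiouville u v p ∧ SolvesSturmLiouville u v q

/-- `Y` is a zero mean Gaussian process with covariance function `k` under `P`. -/
structure IsCenteredGP {T Ω : Type*} [MeasurableSpace Ω] (k : T → T → ℝ) (Y : T → Ω → ℝ)
    (P : Measure Ω) : Prop where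
  isGaussianProcess : IsGaussianProcess Y P
  mean_eq_zero : ∀ x, ∫ ω, Y x ω ∂P = 0
  covariance_eq : ∀ x x', cov[Y x, Y x'; P] = k x x'

/-- The kernel matrix `(k (x_i, x_j))_{i,j}` of the design `X = (x_1, …, x_n)`. -/
def kernelMatrix {T : Type*} {n : ℕ} (k : T → T → ℝ) (X : Fin n → T) :
    Matrix (Fin n) (Fin n) ℝ :=
  Matrix.of fun i j => k (X i) (X j)

/-- The noise-free kriging predictor `k(x)ᵀ K⁻¹ y`, where `k(x) = (k (x, x_i))_i` and
`y = (Y (x_i))_i`. -/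
noncomputable def krigingPredictor {T Ω : Type*} {n : ℕ} (k : T → T → ℝ) (Y : T → Ω → ℝ)
    (X : Fin n → T) (x : T) (ω : Ω) : ℝ :=
  (fun i => k x (X i)) ⬝ᵥ ((kernelMatrix k X)⁻¹ *ᵥ fun i => Y (X i) ω)

/-- The mean squared error of the kriging predictor at `x`, as an element of `[0, ∞]`. -/
noncomputable def krigingMSE {T Ω : Type*} [MeasurableSpace Ω] {n : ℕ} (k : T → T → ℝ)
    (Y : T → Ω → ℝ) (P : Measure Ω) (X : Fin n → T) (x : T) : ℝ≥0∞ :=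
  ∫⁻ ω, ENNReal.ofReal ((krigingPredictor k Y X x ω - Y x ω) ^ 2) ∂P

/-- The dyadic grid `{i * 2^(-τ) : 1 ≤ i ≤ 2^τ - 1}`. -/
def dyadicGrid (τ : ℕ) : Set ℝ := {x | ∃ i : ℕ, 1 ≤ i ∧ i ≤ 2 ^ τ - 1 ∧ x = (i : ℝ) / 2 ^ τ}

/-- The full dyadic lattice of level `τ`: the `d`-fold Cartesian power of `dyadicGrid τ`. -/
def fullGrid (d τ : ℕ) : Set (Fin d → ℝ) := Set.univ.pi fun _ => dyadicGrid τ

/-! One badly predicted point suffices. On a line parallel to an axis, with the other coordinates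
equal to `1/2` (a grid value since `τ ≥ 1`), the kernel is a one-dimensional Markov kernel times a
factor independent of the position on the line. At the midpoint of a grid cell of that line, the
Markov property makes the two neighbouring design points screen off all the others, leaving residual
variance `C q(x)² (F t - F x)(F x - F s)/(F t - F s)` with `F = p/q`. In a fixed ball where `q` and
the slope of `F` are bounded below this is of order `2^(-τ)`, hence at least of order `n^(-1/d)`. -/

/-- If `k(x, ·) = α k(s, ·) + β k(t, ·)` on the design for two design points `s` and `t`, then the
residual variance `k(x, x) - α k(s, x) - β k(t, x)` bounds the kriging error at `x` from below. -/
theorem IsCenteredGP.residual_le_krigingMSE {T Ω : Type*} [MeasurableSpace Ω] {k : T → T → ℝ}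
    {Y : T → Ω → ℝ} {P : Measure Ω} [IsProbabilityMeasure P] (hY : IsCenteredGP k Y P) {n : ℕ}
    (X : Fin n → T) (x : T) (is it : Fin n) (α β : ℝ)
    (hk : ∀ i, k x (X i) = α * k (X is) (X i) + β * k (X it) (X i)) :
    ENNReal.ofReal (k x x - α * k (X is) x - β * k (X it) x) ≤ krigingMSE k Y P X x := by
  have hL (t : T) : MemLp (Y t) 2 P := (hY.isGaussianProcess.hasGaussianLaw_eval t).memLp_two
  -- Only linearity in the observations matters; the weights play no role.
  obtain ⟨a, ha⟩ : ∃ a : Fin n → ℝ,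
      ∀ ω, krigingPredictor k Y X x ω = ∑ i, (a i • Y (X i)) ω := by
    refine ⟨(fun i => k x (X i)) ᵥ* (kernelMatrix k X)⁻¹, fun ω => ?_⟩
    rw [krigingPredictor, dotProduct_mulVec]
    rfl
  set W : Ω → ℝ := ∑ i, a i • Y (X i) with hW
  set Z : Ω → ℝ := Y x - α • Y (X is) - β • Y (X it) with hZ
  have hWL : MemLp W 2 P := memLp_finsetSum' _ fun i _ => (hL _).const_smul _
  have hZL : MemLp Z 2 P := ((hL _).sub ((hL _).const_smul _)).sub ((hL _).const_smul _)
  have hcov (t : T) : cov[Z, Y t; P] = k x t - α * k (X is) t - β * k (X it) t := by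
    rw [hZ, covariance_sub_left ((hL _).sub ((hL _).const_smul _)) ((hL _).const_smul _) (hL _),
      covariance_sub_left (hL _) ((hL _).const_smul _) (hL _), covariance_smul_left,
      covariance_smul_left, hY.covariance_eq, hY.covariance_eq, hY.covariance_eq]
  have hcov0 (i : Fin n) : cov[Z, Y (X i); P] = 0 := by
    rw [hcov, hk]; ring
  have hZZ : cov[Z, Z; P] = cov[Z, Y x; P] := by
    conv_lhs => rw [hZ, ← hZ]
    rw [show cov[Z, Z; P] = cov[Z, Y x - α • Y (X is) - β • Y (X it); P] from rfl,
      covariance_sub_right hZL ((hL _).sub ((hL _).const_smul _)) ((hL _).const_smul _),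
      covariance_sub_right hZL (hL _) ((hL _).const_smul _), covariance_smul_right,
      covariance_smul_right, hcov0, hcov0]
    ring
  have hZW : cov[Z, W; P] = 0 := by
    rw [hW, covariance_sum_right (fun i => (hL _).const_smul _) hZL]
    simp [covariance_smul_right, hcov0]
  have heL : MemLp (W - Y x) 2 P := hWL.sub (hL x)
  -- `Z` is uncorrelated with `W`, and `Var Z = cov(Z, Y x)`, so `0 ≤ Var(W - Y x + Z) = Var(W - Y
  -- x) - cov(Z, Y x)`.
  have hvar : cov[Z, Y x; P] ≤ Var[W - Y x; P] := by
    have h0 := variance_nonneg ((W - Y x) + Z) P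
    rw [variance_add heL hZL, covariance_comm, covariance_sub_right hZL hWL (hL x), hZW,
      ← covariance_self hZL.aemeasurable, hZZ] at h0
    linarith
  have hsq := variance_le_expectation_sq heL.aestronglyMeasurable
  calc ENNReal.ofReal (k x x - α * k (X is) x - β * k (X it) x)
      ≤ ENNReal.ofReal (∫ ω, ((W - Y x) ω) ^ 2 ∂P) := by
        rw [← hcov]
        exact ENNReal.ofReal_le_ofReal (hvar.trans hsq)
    _ = krigingMSE k Y P X x := by
        rw [ofReal_integral_eq_lintegral_ofReal heL.integrable_sq
          (Eventually.of_forall fun ω => sq_nonneg _), krigingMSE]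
        simp only [ha, hW, Pi.sub_apply, Finset.sum_apply]

/-- The Markov kernel `p (x ∧ y) q (x ∨ y)` at an intermediate point `x` is a linear combination of
its values at the two neighbours `s` and `t`. -/
theorem markovKernel_interpolation {p q : ℝ → ℝ} {s x t g : ℝ} (hsx : s ≤ x) (hxt : x ≤ t)
    (hqs : q s ≠ 0) (hqx : q x ≠ 0) (hqt : q t ≠ 0) (hF : p s / q s < p t / q t)
    (hg : g ≤ s ∨ t ≤ g) :
    p (min x g) * q (max x g) =
      ((p t / q t - p x / q x) / (p t / q t - p s / q s) * (q x / q s)) *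
          (p (min s g) * q (max s g)) +
        ((p x / q x - p s / q s) / (p t / q t - p s / q s) * (q x / q t)) *
          (p (min t g) * q (max t g)) := by
  have hD : p t / q t - p s / q s ≠ 0 := (sub_pos.2 hF).ne'
  have hps : p s = p s / q s * q s := by field_simp
  have hpx : p x = p x / q x * q x := by field_simp
  have hpt : p t = p t / q t * q t := by field_simp
  generalize p s / q s = A at *
  generalize p x / q x = B at *
  generalize p t / q t = C at *
  rcases hg with hg | hg
  · rw [min_eq_right hg, max_eq_left hg, min_eq_right (hg.trans hsx), max_eq_left (hg.trans hsx),
      min_eq_right (hg.trans (hsx.trans hxt)), max_eq_left (hg.trans (hsx.trans hxt))]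
    field_simp
    ring
  · rw [min_eq_left hg, max_eq_right hg, min_eq_left (hxt.trans hg), max_eq_right (hxt.trans hg),
      min_eq_left (hsx.trans (hxt.trans hg)), max_eq_right (hsx.trans (hxt.trans hg)), hps, hpx,
      hpt]
    field_simp
    ring

/-- The conditional variance of a Gauss-Markov process at `x` given its values at two neighbours
`s` and `t`. -/
theorem markovKernel_residual {p q : ℝ → ℝ} {s x t : ℝ} (hsx : s ≤ x) (hxt : x ≤ t)
    (hqs : q s ≠ 0) (hqx : q x ≠ 0) (hqt : q t ≠ 0) (hF : p s / q s < p t / q t) :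
    p (min x x) * q (max x x) -
        ((p t / q t - p x / q x) / (p t / q t - p s / q s) * (q x / q s)) *
          (p (min s x) * q (max s x)) -
        ((p x / q x - p s / q s) / (p t / q t - p s / q s) * (q x / q t)) *
          (p (min t x) * q (max t x)) =
      q x ^ 2 * ((p t / q t - p x / q x) * (p x / q x - p s / q s) /
        (p t / q t - p s / q s)) := by
  have hD : p t / q t - p s / q s ≠ 0 := (sub_pos.2 hF).ne'
  rw [min_self, max_self, min_eq_left hsx, max_eq_right hsx, min_eq_right hxt, max_eq_left hxt]
  have hps : p s = p s / q s * q s := by field_simp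
  have hpx : p x = p x / q x * q x := by field_simp
  have hpt : p t = p t / q t * q t := by field_simp
  generalize p s / q s = A at *
  generalize p x / q x = B at *
  generalize p t / q t = C at *
  rw [hps, hpx]
  field_simp
  ring

/-- `A B / (A + B)` increases in each argument and equals `r / 2` at `A = B = r`. -/
theorem half_le_mul_div_add {A B r : ℝ} (hr : 0 < r) (hA : r ≤ A) (hB : r ≤ B) :
    r / 2 ≤ A * B / (A + B) := by
  rw [le_div_iff₀ (by linarith)]
  nlinarith [mul_nonneg (sub_nonneg.2 hA) (sub_nonneg.2 hB)]

/-- Around some point of `(0,1)`, `q` and the slope of `p / q` are bounded away from zero. -/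
theorem IsMarkovPair.exists_ball {p q : ℝ → ℝ} (h : IsMarkovPair (Ioo 0 1) p q)
    (hp : ContDiffOn ℝ 1 p (Ioo 0 1)) (hq : ContDiffOn ℝ 1 q (Ioo 0 1)) :
    ∃ x₀ δ m : ℝ, 0 < δ ∧ 0 < m ∧ Metric.ball x₀ δ ⊆ Ioo 0 1 ∧
      (∀ x ∈ Metric.ball x₀ δ, m ≤ q x) ∧
      ∀ x ∈ Metric.ball x₀ δ, ∀ y ∈ Metric.ball x₀ δ, x ≤ y →
        m * (y - x) ≤ p y / q y - p x / q x := by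
  set F : ℝ → ℝ := fun x => p x / q x with hFdef
  have hF : ContDiffOn ℝ 1 F (Ioo 0 1) := hp.div hq fun x hx => (h.pos_right x hx).ne'
  have hdF : ContinuousOn (deriv F) (Ioo 0 1) := hF.continuousOn_deriv_of_isOpen isOpen_Ioo le_rfl
  have hsub : Icc (1 / 4 : ℝ) (3 / 4) ⊆ Ioo 0 1 := fun x hx =>
    ⟨by linarith [hx.1], by linarith [hx.2]⟩
  -- Strict monotonicity alone allows zeros of the derivative; the mean value theorem finds a point
  -- where it is positive, and continuity extends this to a ball.
  obtain ⟨x₀, hx₀, hslope⟩ := exists_deriv_eq_slope F (a := 1 / 4) (b := 3 / 4) (by norm_num)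
    (hF.continuousOn.mono hsub)
    ((hF.differentiableOn one_ne_zero).mono (Ioo_subset_Icc_self.trans hsub))
  have hx₀' : x₀ ∈ Ioo (0 : ℝ) 1 := hsub (Ioo_subset_Icc_self hx₀)
  have hpos : 0 < deriv F x₀ := by
    rw [hslope]
    refine div_pos (sub_pos.2 (h.strictMonoOn_div ?_ ?_ ?_)) ?_ <;> norm_num
  have hnhds := isOpen_Ioo.mem_nhds hx₀'
  obtain ⟨m, hm0, hm⟩ := exists_between (lt_min hpos (h.pos_right x₀ hx₀'))
  have hev : ∀ᶠ x in nhds x₀, x ∈ Ioo (0 : ℝ) 1 ∧ m < deriv F x ∧ m < q x := by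
    filter_upwards [hnhds,
      (hdF.continuousAt hnhds).eventually (lt_mem_nhds (hm.trans_le (min_le_left _ _))),
      (hq.continuousOn.continuousAt hnhds).eventually
        (lt_mem_nhds (hm.trans_le (min_le_right _ _)))] with x h1 h2 h3
    exact ⟨h1, h2, h3⟩
  obtain ⟨δ, hδ, hball⟩ := Metric.eventually_nhds_iff_ball.1 hev
  refine ⟨x₀, δ, m, hδ, hm0, fun x hx => (hball x hx).1, fun x hx => (hball x hx).2.2.le,
    (convex_ball x₀ δ).mul_sub_le_image_sub_of_le_deriv
      (hF.continuousOn.mono fun x hx => (hball x hx).1) ?_ ?_⟩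
  · rw [Metric.isOpen_ball.interior_eq]
    exact (hF.differentiableOn one_ne_zero).mono fun x hx => (hball x hx).1
  · rw [Metric.isOpen_ball.interior_eq]
    exact fun x hx => (hball x hx).2.1.le

/-- A ball inside `(0,1)` contains a full cell of every sufficiently fine dyadic grid. -/
theorem exists_dyadic_cell {x₀ δ : ℝ} (hball : Metric.ball x₀ δ ⊆ Ioo 0 1) {τ : ℕ}
    (hτ : ((2 : ℝ) ^ τ)⁻¹ < δ) :
    ∃ s, s ∈ Metric.ball x₀ δ ∧ s + ((2 : ℝ) ^ τ)⁻¹ ∈ Metric.ball x₀ δ ∧ s ∈ dyadicGrid τ ∧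
      s + ((2 : ℝ) ^ τ)⁻¹ ∈ dyadicGrid τ ∧
      ∀ g ∈ dyadicGrid τ, g ≤ s ∨ s + ((2 : ℝ) ^ τ)⁻¹ ≤ g := by
  have hN : (0 : ℝ) < 2 ^ τ := by positivity
  have hh : (0 : ℝ) < ((2 : ℝ) ^ τ)⁻¹ := inv_pos.2 hN
  have hx₀ := hball (Metric.mem_ball_self (hh.trans hτ))
  set i := ⌊x₀ * 2 ^ τ⌋₊ with hi
  have h1 : (i : ℝ) ≤ x₀ * 2 ^ τ := Nat.floor_le (mul_nonneg hx₀.1.le hN.le)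
  have h2 : x₀ * 2 ^ τ < i + 1 := Nat.lt_floor_add_one _
  have hs1 : (i : ℝ) / 2 ^ τ ≤ x₀ := (div_le_iff₀ hN).2 h1
  have ht : (i : ℝ) / 2 ^ τ + ((2 : ℝ) ^ τ)⁻¹ = ((i + 1 : ℕ) : ℝ) / 2 ^ τ := by
    push_cast; rw [add_div, one_div]
  have hs2 : x₀ < (i : ℝ) / 2 ^ τ + ((2 : ℝ) ^ τ)⁻¹ := by
    rw [ht, lt_div_iff₀ hN]; exact_mod_cast h2
  have hsb : (i : ℝ) / 2 ^ τ ∈ Metric.ball x₀ δ := by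
    rw [Metric.mem_ball, Real.dist_eq, abs_lt]; constructor <;> linarith
  have htb : (i : ℝ) / 2 ^ τ + ((2 : ℝ) ^ τ)⁻¹ ∈ Metric.ball x₀ δ := by
    rw [Metric.mem_ball, Real.dist_eq, abs_lt]; constructor <;> linarith
  -- Both ends of the cell lie in `(0,1)`, so neither is a boundary node missing from the grid.
  have hi0 : 0 < i := by
    have := (hball hsb).1
    rw [lt_div_iff₀ hN, zero_mul] at this
    exact_mod_cast this
  have hi1 : i + 1 < 2 ^ τ := by
    have := (hball htb).2
    rw [ht, div_lt_iff₀ hN, one_mul] at this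
    exact_mod_cast this
  refine ⟨(i : ℝ) / 2 ^ τ, hsb, htb, ⟨i, hi0, by omega, rfl⟩,
    ⟨i + 1, by omega, by omega, ht⟩, ?_⟩
  rintro g ⟨l, -, -, rfl⟩
  rw [ht]
  rcases le_or_gt l i with hl | hl
  · left; gcongr
  · right; gcongr; omega

theorem half_mem_dyadicGrid {τ : ℕ} (hτ : 1 ≤ τ) : (1 / 2 : ℝ) ∈ dyadicGrid τ := by
  obtain ⟨k, rfl⟩ := Nat.exists_eq_add_of_le' hτ
  have := Nat.one_le_two_pow (n := k)
  refine ⟨2 ^ k, this, by rw [pow_succ]; omega, ?_⟩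
  push_cast
  field_simp
  ring

theorem ncard_dyadicGrid (τ : ℕ) : (dyadicGrid τ).ncard = 2 ^ τ - 1 := by
  have : dyadicGrid τ = (fun i : ℕ => (i : ℝ) / 2 ^ τ) '' (Finset.Icc 1 (2 ^ τ - 1) : Finset ℕ) := by
    ext x
    simp only [dyadicGrid, Set.mem_ofPred_eq, Set.mem_image, Finset.coe_Icc, Set.mem_Icc]
    exact exists_congr fun i => ⟨fun h => ⟨⟨h.1, h.2.1⟩, h.2.2.symm⟩,
      fun h => ⟨h.1.1, h.1.2, h.2.symm⟩⟩
  rw [this, Set.ncard_image_of_injective, Set.ncard_coe_finset, Nat.card_Icc, Nat.add_sub_cancel]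
  intro i j hij
  have h2 : (2 : ℝ) ^ τ ≠ 0 := by positivity
  simpa [div_left_inj' h2] using hij

theorem ncard_fullGrid (d τ : ℕ) : (fullGrid d τ).ncard = (2 ^ τ - 1) ^ d := by
  rw [fullGrid, ← Nat.card_coe_set_eq,
    Nat.card_congr (Equiv.Set.univPi fun _ : Fin d => dyadicGrid τ), Nat.card_pi]
  simp [Nat.card_coe_set_eq, ncard_dyadicGrid]

theorem card_design {d τ n : ℕ} {X : Fin n → openCube d} (hX : Function.Injective X)
    (hr : Set.range (fun i => (X i : Fin d → ℝ)) = fullGrid d τ) : n = (2 ^ τ - 1) ^ d := by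
  rw [← ncard_fullGrid, ← hr, ← Set.image_univ,
    Set.ncard_image_of_injective Set.univ fun _ _ h => hX (Subtype.val_injective h),
    Set.ncard_univ, Nat.card_fin]

/-- The left side is `1 / (2^τ - 1)`, and `2^τ ≤ 2 (2^τ - 1)`. -/
theorem rpow_neg_inv_le {d τ n : ℕ} (hd : 1 ≤ d) (hτ : 1 ≤ τ) (hn : n = (2 ^ τ - 1) ^ d) :
    (n : ℝ) ^ (-(1 / (d : ℝ))) ≤ 2 * ((2 : ℝ) ^ τ)⁻¹ := by
  have h2 : (2 : ℝ) ≤ 2 ^ τ := by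
    simpa using pow_le_pow_right₀ (one_le_two : (1 : ℝ) ≤ 2) hτ
  have hcast : (n : ℝ) = ((2 : ℝ) ^ τ - 1) ^ d := by
    rw [hn, Nat.cast_pow, Nat.cast_sub Nat.one_le_two_pow]; push_cast; rfl
  rw [hcast, Real.rpow_neg (by apply pow_nonneg; linarith), one_div,
    Real.pow_rpow_inv_natCast (by linarith) (by omega), ← div_eq_mul_inv, inv_eq_one_div,
    div_le_div_iff₀ (by linarith) (by linarith)]
  linarith

/-- The point of the line `{x : x_l = 1/2 for l ≠ j}` with `j`-th coordinate `y`. -/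
noncomputable def axisPoint {d : ℕ} (j : Fin d) (y : ℝ) : Fin d → ℝ :=
  Function.update (fun _ => 1 / 2) j y

theorem axisPoint_mem_pi {d : ℕ} {I : Set ℝ} (hI : (1 / 2 : ℝ) ∈ I) (j : Fin d) {y : ℝ}
    (hy : y ∈ I) : axisPoint j y ∈ Set.univ.pi fun _ : Fin d => I := by
  intro l _
  by_cases h : l = j
  · subst h; simpa [axisPoint] using hy
  · simpa [axisPoint, h] using hI

/-- The product over `l ≠ j` does not involve `y`, so one-dimensional interpolation identities lift
to the tensor kernel. -/
theorem tmKernel_axisPoint {d : ℕ} (p q : Fin d → ℝ → ℝ) (j : Fin d) {y : ℝ} {x : openCube d}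
    (hx : x.1 = axisPoint j y) (z : openCube d) :
    tmKernel p q x z = p j (min y (z.1 j)) * q j (max y (z.1 j)) *
      ∏ l ∈ Finset.univ.erase j, p l (min (1 / 2) (z.1 l)) * q l (max (1 / 2) (z.1 l)) := by
  rw [tmKernel, ← Finset.mul_prod_erase _ _ (Finset.mem_univ j), hx]
  congr 1
  · simp [axisPoint]
  · refine Finset.prod_congr rfl fun l hl => ?_
    rw [axisPoint, Function.update_of_ne (Finset.ne_of_mem_erase hl)]

theorem tmKernel_axisPoint_axisPoint {d : ℕ} (p q : Fin d → ℝ → ℝ) (j : Fin d) {y y' : ℝ}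
    {x x' : openCube d} (hx : x.1 = axisPoint j y) (hx' : x'.1 = axisPoint j y') :
    tmKernel p q x x' = p j (min y y') * q j (max y y') *
      ∏ l ∈ Finset.univ.erase j, p l (1 / 2) * q l (1 / 2) := by
  rw [tmKernel_axisPoint p q j hx, hx']
  congr 1
  · simp [axisPoint]
  · refine Finset.prod_congr rfl fun l hl => ?_
    rw [axisPoint, Function.update_of_ne (Finset.ne_of_mem_erase hl), min_self, max_self]

theorem proposition2 {d : ℕ} (hd : 1 ≤ d) (p q : Fin d → ℝ → ℝ)
    (hpq : ∀ j, IsMarkovPair (Set.Ioo 0 1) (p j) (q j))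
    (hSL : ∀ j, SturmLiouvilleRegular (p j) (q j))
    {Ω : Type*} [MeasurableSpace Ω] (P : Measure Ω) [IsProbabilityMeasure P]
    (Y : openCube d → Ω → ℝ) (hY : IsCenteredGP (tmKernel p q) Y P) :
    ∃ c : ℝ, 0 < c ∧ ∀ᶠ n : ℕ in atTop, ∀ τ : ℕ, 1 ≤ τ → ∀ X : Fin n → openCube d,
      Function.Injective X → Set.range (fun i => (X i : Fin d → ℝ)) = fullGrid d τ →
      ENNReal.ofReal (c * (n : ℝ) ^ (-(1 / (d : ℝ)))) ≤
        ⨆ x : openCube d, krigingMSE (tmKernel p q) Y P X x := by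
  let j : Fin d := ⟨0, hd⟩
  obtain ⟨x₀, δ, m, hδ, hm, hball, hqm, hFm⟩ :=
    (hpq j).exists_ball (hSL j).contDiffOn_left (hSL j).contDiffOn_right
  have half_mem : (1 / 2 : ℝ) ∈ Ioo (0 : ℝ) 1 := by norm_num
  set C : ℝ := ∏ l ∈ Finset.univ.erase j, p l (1 / 2) * q l (1 / 2) with hC
  have hC0 : 0 < C := Finset.prod_pos fun l _ =>
    mul_pos ((hpq l).pos_left _ half_mem) ((hpq l).pos_right _ half_mem)
  obtain ⟨τ₀, hτ₀⟩ := exists_pow_lt_of_lt_one hδ (by norm_num : (1 / 2 : ℝ) < 1)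
  -- `q²` gives `m²`, the increments of `F` give `m h / 4`, and `h ≥ n^(-1/d) / 2`.
  refine ⟨C * m ^ 3 / 8, by positivity, ?_⟩
  filter_upwards [eventually_ge_atTop ((2 ^ τ₀) ^ d)] with n hn τ hτ X hX hr
  have hcard := card_design hX hr
  -- Large `n` forces a fine grid, since `n = (2^τ - 1)^d`.
  have hττ : τ₀ ≤ τ := by
    by_contra! hlt
    have h1 : 2 ^ τ ≤ 2 ^ τ₀ := Nat.pow_le_pow_right two_pos hlt.le
    have h2 : 0 < 2 ^ τ₀ := by positivity
    have h3 : (2 ^ τ - 1) ^ d < (2 ^ τ₀) ^ d := Nat.pow_lt_pow_left (by omega) (by omega)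
    omega
  set h : ℝ := ((2 : ℝ) ^ τ)⁻¹ with hh
  have hh0 : 0 < h := by positivity
  have hhδ : h < δ := by
    refine lt_of_le_of_lt ?_ hτ₀
    rw [one_div, inv_pow]
    exact inv_anti₀ (by positivity) (pow_le_pow_right₀ one_le_two hττ)
  obtain ⟨s, hsb, htb, hs, ht, hst⟩ := exists_dyadic_cell hball hhδ
  rw [← hh] at htb ht hst
  have hxb : s + h / 2 ∈ Metric.ball x₀ δ := by
    rw [Metric.mem_ball, Real.dist_eq, abs_lt] at *
    constructor <;> linarith
  obtain ⟨is, his⟩ : axisPoint j s ∈ Set.range (fun i => (X i : Fin d → ℝ)) :=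
    hr ▸ axisPoint_mem_pi (half_mem_dyadicGrid hτ) j hs
  obtain ⟨it, hit⟩ : axisPoint j (s + h) ∈ Set.range (fun i => (X i : Fin d → ℝ)) :=
    hr ▸ axisPoint_mem_pi (half_mem_dyadicGrid hτ) j ht
  let x : openCube d := ⟨axisPoint j (s + h / 2), axisPoint_mem_pi half_mem j (hball hxb)⟩
  have hA := hFm _ hsb _ hxb (by linarith)
  have hB := hFm _ hxb _ htb (by linarith)
  have hr0 : 0 < m * (h / 2) := by positivity
  have hF : p j s / q j s < p j (s + h) / q j (s + h) := by nlinarith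
  have hqs := ((hpq j).pos_right _ (hball hsb)).ne'
  have hqx := ((hpq j).pos_right _ (hball hxb)).ne'
  have hqt := ((hpq j).pos_right _ (hball htb)).ne'
  have hsx : s ≤ s + h / 2 := by linarith
  have hxt : s + h / 2 ≤ s + h := by linarith
  have hgrid (i : Fin n) : (X i).1 j ∈ dyadicGrid τ := by
    have : (X i).1 ∈ fullGrid d τ := hr ▸ ⟨i, rfl⟩
    exact this j (Set.mem_univ j)
  let A : ℝ → ℝ := fun y => p j y / q j y
  have key := hY.residual_le_krigingMSE X x is it
    ((A (s + h) - A (s + h / 2)) / (A (s + h) - A s) * (q j (s + h / 2) / q j s))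
    ((A (s + h / 2) - A s) / (A (s + h) - A s) * (q j (s + h / 2) / q j (s + h))) fun i => by
      rw [tmKernel_axisPoint p q j (x := x) rfl, tmKernel_axisPoint p q j his,
        tmKernel_axisPoint p q j hit,
        markovKernel_interpolation hsx hxt hqs hqx hqt hF (hst _ (hgrid i)), add_mul]
      exact congrArg₂ (· + ·) (mul_assoc _ _ _) (mul_assoc _ _ _)
  simp only [A] at key
  refine le_trans (ENNReal.ofReal_le_ofReal ?_) (key.trans (le_iSup _ x))
  rw [tmKernel_axisPoint_axisPoint p q j (x := x) (x' := x) rfl rfl,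
    tmKernel_axisPoint_axisPoint p q j (x' := x) his rfl,
    tmKernel_axisPoint_axisPoint p q j (x' := x) hit rfl, ← hC, ← mul_assoc _ _ C, ← mul_assoc _ _ C,
    ← sub_mul, ← sub_mul, markovKernel_residual hsx hxt hqs hqx hqt hF]
  have hres := half_le_mul_div_add hr0 (by linarith [hB] : m * (h / 2) ≤
    p j (s + h) / q j (s + h) - p j (s + h / 2) / q j (s + h / 2)) (by linarith [hA] :
    m * (h / 2) ≤ p j (s + h / 2) / q j (s + h / 2) - p j s / q j s)
  rw [sub_add_sub_cancel] at hres
  calc C * m ^ 3 / 8 * (n : ℝ) ^ (-(1 / (d : ℝ)))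
      ≤ C * m ^ 3 / 8 * (2 * h) := by
        gcongr
        exact rpow_neg_inv_le hd hτ hcard
    _ = m ^ 2 * (m * (h / 2) / 2) * C := by ring
    _ ≤ _ := by
        gcongr
        exact hqm _ hxb
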